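/- Let $\mathbb{T}=\{z\in\mathbb{C}:|z|=1\}$; by a measure on $\mathbb{T}$ we mean a finite positive Borel measure, and such a measure is called continuous if it vanishes on every one-point set. For measures $\nu_1,\dots,\nu_n$ on $\mathbb{T}$ let $\nu_1\ast\dots\ast\nu_n$ be their convolution, i.e. the image of $\nu_1\otimes\dots\otimes\nu_n$ under $(z_1,\dots,z_n)\mapsto z_1\cdots z_n$, and let $\sigma^{\ast k}$ be the $k$-fold convolution of $\sigma$ with itself. A measure $\mu$ on $\mathbb{T}$ has the property $CS(n)$ if $\mu\perp\nu_1\ast\dots\ast\nu_n$ for all continuous measures $\nu_1,\dots,\nu_n$ on $\mathbb{T}$. For a measure $\sigma$ on $\mathbb{T}$ let $V_\sigma$ be the unitary operator $(V_\sigma f)(z)=zf(z)$ on $H=L^2(\mathbb{T},\sigma)$, and let $V_\sigma^{\odot n}$ be the restriction of $V_\sigma^{\otimes n}$ to the subspace $H^{\odot n}$ of those elements of the Hilbert space tensor power $H^{\otimes n}$ that are invariant under all permutations of the tensor factors. A unitary operator $U$ of a separable Hilbert space $K$ has simple spectrum if its spectral multiplicity function equals $1$ almost everywhere with respect to its maximal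 spectral type; that is, if there are $x_1,x_2,\dots\in K$ with $K=\bigoplus_{n\ge1}\overline{\mathrm{span}}\{U^jx_n: j\in\mathbb{Z}\}$ (an orthogonal sum) whose spectral measures $\sigma_{x_n}$ (determined by $\langle U^jx_n,x_n\rangle=\int_{\mathbb{T}}z^j\,d\sigma_{x_n}(z)$ for all $j\in\mathbb{Z}$) satisfy $\sigma_{x_1}\gg\sigma_{x_2}\gg\cdots$, and such that for $\sigma_{x_1}$-almost every $z$ exactly one $n$ satisfies $\frac{d\sigma_{x_n}}{d\sigma_{x_1}}(z)\ne0$. Let $\sigma$ be a continuous measure on $\mathbb{T}$. If $V_\sigma^{\odot n}$ has simple spectrum for infinitely many $n\in\mathbb{N}$, then for every $k\ge1$ the measure $\sigma^{\ast k}$ has the property $CS(k+1)$. -/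

import Mathlib

open MeasureTheory
open scoped TensorProduct ComplexConjugate

noncomputable section

/-! ### Measures on the circle group -/

/-- The circle group `𝕋 = {z ∈ ℂ : |z| = 1}` with its Borel `σ`-algebra. -/
instance Circle.instMeasurableSpaceBorel : MeasurableSpace Circle := borel Circle

instance Circle.instBorelSpaceBorel : BorelSpace Circle := ⟨rfl⟩

/-- The convolution `ν₁ ∗ ⋯ ∗ νₙ`: the image of the product measure `ν₁ ⊗ ⋯ ⊗ νₙ` under
`(z₁, …, zₙ) ↦ z₁ ⋯ zₙ`. -/
def circleConv {n : ℕ} (ν : Fin n → Measure Circle) : Measure Circle :=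
  (Measure.pi ν).map (fun z => ∏ i, z i)

/-- The convolution power `σ^{∗k}`. -/
def convPow (σ : Measure Circle) (k : ℕ) : Measure Circle :=
  circleConv (fun _ : Fin k => σ)

/-- The convolution singularity property of order `n`: `σ` is singular with respect to the
convolution of any `n` continuous (that is, vanishing on points) finite measures. -/
def HasCS (σ : Measure Circle) (n : ℕ) : Prop :=
  ∀ ν : Fin n → Measure Circle, (∀ i, IsFiniteMeasure (ν i)) →
    (∀ i, NullSingletonClass (ν i)) → σ ⟂ₘ circleConv ν

/-! ### Tensor powers of a Hilbert space -/

section TensorPower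

variable (H : Type*) [NormedAddCommGroup H] [InnerProductSpace ℂ H] (n : ℕ)

/-- The algebraic tensor power, as a type of its own: it carries the Hilbert space inner product
and not one of the Banach space tensor seminorms. -/
def AlgTensorPower : Type _ := ⨂[ℂ] _ : Fin n, H

namespace AlgTensorPower

instance : AddCommGroup (AlgTensorPower H n) :=
  inferInstanceAs (AddCommGroup (⨂[ℂ] _ : Fin n, H))

instance : Module ℂ (AlgTensorPower H n) :=
  inferInstanceAs (Module ℂ (⨂[ℂ] _ : Fin n, H))

variable {H n}

/-- The elementary tensor `x₁ ⊗ ⋯ ⊗ xₙ`, as a multilinear map. -/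
def tprod : MultilinearMap ℂ (fun _ : Fin n => H) (AlgTensorPower H n) :=
  PiTensorProduct.tprod ℂ

/-- The linear functional with `y₁ ⊗ ⋯ ⊗ yₙ ↦ ∏ᵢ ⟪xᵢ, yᵢ⟫`. -/
def pairing (x : Fin n → H) : AlgTensorPower H n →ₗ[ℂ] ℂ :=
  PiTensorProduct.lift ((MultilinearMap.mkPiAlgebra ℂ (Fin n) ℂ).compLinearMap
    (fun i => (innerₛₗ ℂ (x i) : H →ₗ[ℂ] ℂ)))

theorem pairing_tprod (x y : Fin n → H) :
    pairing x (tprod y) = ∏ i, inner ℂ (x i) (y i) :=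
  (PiTensorProduct.lift.tprod _).trans (by simp)

theorem conj_pairing_tprod (x y : Fin n → H) :
    conj (pairing y (tprod x)) = pairing x (tprod y) := by
  simp [pairing_tprod]

theorem span_range_tprod :
    Submodule.span ℂ (Set.range (tprod : (Fin n → H) → AlgTensorPower H n)) = ⊤ :=
  PiTensorProduct.span_tprod_eq_top

/-- The form `(x, y) ↦ ⟪x, y⟫`, conjugate linear in `x` and linear in `y`, with
`⟪x₁ ⊗ ⋯ ⊗ xₙ, y₁ ⊗ ⋯ ⊗ yₙ⟫ = ∏ᵢ ⟪xᵢ, yᵢ⟫`; the argument `y` comes first here. -/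
def form : AlgTensorPower H n →ₗ[ℂ] (AlgTensorPower H n →ₗ⋆[ℂ] ℂ) :=
  PiTensorProduct.lift
    { toFun := fun y => (starLinearEquiv ℂ : ℂ ≃ₗ⋆[ℂ] ℂ).toLinearMap.comp (pairing y)
      map_update_add' := by
        intro _ m i a b
        refine LinearMap.ext_on_range (v := tprod) span_range_tprod fun x => ?_
        have h (y : Fin n → H) : star (pairing y (tprod x)) = pairing x (tprod y) :=
          conj_pairing_tprod x y
        have e := (tprod (H := H) (n := n)).map_update_add m i a b
        simp only [LinearMap.add_apply, LinearMap.comp_apply, LinearEquiv.coe_coe,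
          starLinearEquiv_apply, h]
        rw [← map_add, ← e]
      map_update_smul' := by
        intro _ m i c a
        refine LinearMap.ext_on_range (v := tprod) span_range_tprod fun x => ?_
        have h (y : Fin n → H) : star (pairing y (tprod x)) = pairing x (tprod y) :=
          conj_pairing_tprod x y
        have e := (tprod (H := H) (n := n)).map_update_smul m i c a
        simp only [LinearMap.smul_apply, LinearMap.comp_apply, LinearEquiv.coe_coe,
          starLinearEquiv_apply, h]
        rw [← map_smul, ← e] }

theorem form_tprod (x y : Fin n → H) :
    form (tprod y) (tprod x) = ∏ i, inner ℂ (x i) (y i) := by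
  have h : form (tprod y) =
      (starLinearEquiv ℂ : ℂ ≃ₗ⋆[ℂ] ℂ).toLinearMap.comp (pairing y) :=
    PiTensorProduct.lift.tprod _
  rw [h, ← pairing_tprod, ← conj_pairing_tprod]
  rfl

theorem conj_form (x y : AlgTensorPower H n) : conj (form x y) = form y x := by
  have hx : x ∈ Submodule.span ℂ (Set.range (tprod : (Fin n → H) → AlgTensorPower H n)) := by
    rw [span_range_tprod]; trivial
  have hy : y ∈ Submodule.span ℂ (Set.range (tprod : (Fin n → H) → AlgTensorPower H n)) := by
    rw [span_range_tprod]; trivial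
  induction hx, hy using Submodule.span_induction₂ with
  | mem_mem x y hx hy =>
    obtain ⟨a, rfl⟩ := hx
    obtain ⟨b, rfl⟩ := hy
    simp [form_tprod]
  | zero_left y hy => simp
  | zero_right x hx => simp
  | add_left x y z hx hy hz h1 h2 => simp [h1, h2]
  | add_right x y z hx hy hz h1 h2 => simp [h1, h2]
  | smul_left r x y hx hy h => simp [h]
  | smul_right r x y hx hy h => simp [h]

open scoped ComplexOrder in
theorem posSemidef_prod_inner {ι : Type*} [Finite ι] (a : ι → Fin n → H) (s : Finset (Fin n)) :
    (Matrix.of fun j k => ∏ i ∈ s, inner ℂ (a j i) (a k i)).PosSemidef := by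
  classical
  induction s using Finset.induction_on with
  | empty =>
    have h := Matrix.posSemidef_gram (𝕜 := ℂ) (fun _ : ι => (1 : ℂ))
    have e : (Matrix.of fun j k : ι => ∏ i ∈ (∅ : Finset (Fin n)), inner ℂ (a j i) (a k i)) =
        Matrix.gram ℂ (fun _ : ι => (1 : ℂ)) := by
      ext j k
      simp
    rw [e]
    exact h
  | insert i s hi ih =>
    have h := (Matrix.posSemidef_gram (𝕜 := ℂ) (fun j : ι => a j i)).hadamard ih
    have e : (Matrix.of fun j k : ι => ∏ i ∈ insert i s, inner ℂ (a j i) (a k i)) =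
        (Matrix.gram ℂ fun j => a j i).hadamard
          (Matrix.of fun j k => ∏ i ∈ s, inner ℂ (a j i) (a k i)) := by
      ext j k
      simp [Finset.prod_insert hi]
    rw [e]
    exact h

open scoped ComplexOrder in
theorem form_self_nonneg (x : AlgTensorPower H n) : 0 ≤ form x x := by
  have hx : x ∈ Submodule.span ℂ (Set.range (tprod : (Fin n → H) → AlgTensorPower H n)) := by
    rw [span_range_tprod]; trivial
  obtain ⟨c, rfl⟩ := (Finsupp.mem_span_range_iff_exists_finsupp).1 hx
  have h := (posSemidef_prod_inner (fun j : c.support => (j : Fin n → H))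
    Finset.univ).dotProduct_mulVec_nonneg (fun j => c j)
  convert h using 1
  simp only [Finsupp.sum, map_sum, map_smul, map_smulₛₗ, LinearMap.sum_apply,
    LinearMap.smul_apply, form_tprod, dotProduct, Matrix.mulVec, Matrix.of_apply,
    Finset.mul_sum, Pi.star_apply, smul_eq_mul]
  rw [Finset.sum_coe_sort c.support (fun j : Fin n → H => ∑ k : c.support,
    star (c j) * ((∏ i, inner ℂ (j i) ((k : Fin n → H) i)) * c k))]
  refine Finset.sum_congr rfl fun j _ => ?_
  rw [Finset.sum_coe_sort c.support (fun k : Fin n → H =>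
    star (c j) * ((∏ i, inner ℂ (j i) (k i)) * c k))]
  refine Finset.sum_congr rfl fun k _ => ?_
  simp only [starRingEnd_apply]
  ring

/-- The (pre-)inner product of the tensor power. -/
instance : PreInnerProductSpace.Core ℂ (AlgTensorPower H n) where
  inner x y := form y x
  conj_inner_symm x y := conj_form x y
  re_inner_nonneg x := (Complex.le_def.1 (form_self_nonneg x)).1
  add_left x y z := by simp
  smul_left x y r := by simp

instance : SeminormedAddCommGroup (AlgTensorPower H n) :=
  InnerProductSpace.Core.toSeminormedAddCommGroup (𝕜 := ℂ)

instance : InnerProductSpace ℂ (AlgTensorPower H n) :=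
  InnerProductSpace.ofCore _

theorem inner_tprod (x y : Fin n → H) :
    inner ℂ (tprod x) (tprod y) = ∏ i, inner ℂ (x i) (y i) :=
  form_tprod x y

end AlgTensorPower

/-- The Hilbert space tensor power `H^{⊗n}`: the completion of the algebraic tensor power for the
inner product `⟪x₁ ⊗ ⋯ ⊗ xₙ, y₁ ⊗ ⋯ ⊗ yₙ⟫ = ∏ᵢ ⟪xᵢ, yᵢ⟫`. -/
abbrev HilbertTensorPower : Type _ := UniformSpace.Completion (AlgTensorPower H n)

namespace HilbertTensorPower

variable {H n}

/-- The elementary tensor `x₁ ⊗ ⋯ ⊗ xₙ` in `H^{⊗n}`. -/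
def tprod (x : Fin n → H) : HilbertTensorPower H n :=
  ((AlgTensorPower.tprod x : AlgTensorPower H n) : HilbertTensorPower H n)

theorem inner_tprod (x y : Fin n → H) :
    inner ℂ (tprod x) (tprod y) = ∏ i, inner ℂ (x i) (y i) :=
  (UniformSpace.Completion.inner_coe _ _).trans (AlgTensorPower.inner_tprod x y)

theorem norm_eq_of_form_eq (f : AlgTensorPower H n →ₗ[ℂ] AlgTensorPower H n)
    (hf : ∀ x y : Fin n → H, AlgTensorPower.form (f (AlgTensorPower.tprod y))
      (f (AlgTensorPower.tprod x)) = ∏ i, inner ℂ (x i) (y i)) (x : AlgTensorPower H n) :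
    ‖f x‖ = ‖x‖ := by
  have key (x y : AlgTensorPower H n) :
      AlgTensorPower.form (f x) (f y) = AlgTensorPower.form x y := by
    have hx : x ∈ Submodule.span ℂ
        (Set.range (AlgTensorPower.tprod : (Fin n → H) → AlgTensorPower H n)) := by
      rw [AlgTensorPower.span_range_tprod]; trivial
    have hy : y ∈ Submodule.span ℂ
        (Set.range (AlgTensorPower.tprod : (Fin n → H) → AlgTensorPower H n)) := by
      rw [AlgTensorPower.span_range_tprod]; trivial
    induction hx, hy using Submodule.span_induction₂ with
    | mem_mem x y hx hy =>
      obtain ⟨a, rfl⟩ := hx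
      obtain ⟨b, rfl⟩ := hy
      rw [hf, AlgTensorPower.form_tprod]
    | zero_left y hy => simp
    | zero_right x hx => simp
    | add_left x y z hx hy hz h1 h2 => simp [h1, h2]
    | add_right x y z hx hy hz h1 h2 => simp [h1, h2]
    | smul_left r x y hx hy h => simp [h]
    | smul_right r x y hx hy h => simp [h]
  rw [norm_eq_sqrt_re_inner (𝕜 := ℂ), norm_eq_sqrt_re_inner (𝕜 := ℂ) x]
  exact congrArg (fun t => Real.sqrt (RCLike.re t)) (key x x)

/-- The extension to `H^{⊗n}` of a bijective linear isometry of the algebraic tensor power. -/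
def extend (f : AlgTensorPower H n ≃ₗ[ℂ] AlgTensorPower H n) (hf : ∀ x, ‖f x‖ = ‖x‖) :
    HilbertTensorPower H n ≃ₗᵢ[ℂ] HilbertTensorPower H n :=
  f.extendOfIsometry
    (UniformSpace.Completion.toComplₗᵢ (𝕜 := ℂ) (E := AlgTensorPower H n)).toLinearMap
    (UniformSpace.Completion.toComplₗᵢ (𝕜 := ℂ) (E := AlgTensorPower H n)).toLinearMap
    UniformSpace.Completion.denseRange_coe UniformSpace.Completion.denseRange_coe
    (fun x => by simpa using hf x)

theorem extend_coe (f : AlgTensorPower H n ≃ₗ[ℂ] AlgTensorPower H n) (hf : ∀ x, ‖f x‖ = ‖x‖)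
    (x : AlgTensorPower H n) :
    extend f hf (x : HilbertTensorPower H n) = ((f x : AlgTensorPower H n) : HilbertTensorPower H n) :=
  LinearEquiv.extendOfIsometry_eq ..

/-- `x₁ ⊗ ⋯ ⊗ xₙ ↦ Ux₁ ⊗ ⋯ ⊗ Uxₙ` on the algebraic tensor power. -/
def algMap (U : H ≃ₗᵢ[ℂ] H) (n : ℕ) : AlgTensorPower H n ≃ₗ[ℂ] AlgTensorPower H n :=
  PiTensorProduct.congr fun _ : Fin n => U.toLinearEquiv

theorem algMap_tprod (U : H ≃ₗᵢ[ℂ] H) (x : Fin n → H) :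
    algMap U n (AlgTensorPower.tprod x) = AlgTensorPower.tprod (fun i => U (x i)) :=
  PiTensorProduct.congr_tprod _ _

/-- `x₁ ⊗ ⋯ ⊗ xₙ ↦ x_{π(1)} ⊗ ⋯ ⊗ x_{π(n)}` on the algebraic tensor power. -/
def algPerm (π : Equiv.Perm (Fin n)) : AlgTensorPower H n ≃ₗ[ℂ] AlgTensorPower H n :=
  PiTensorProduct.reindex ℂ (fun _ : Fin n => H) π.symm

theorem algPerm_tprod (π : Equiv.Perm (Fin n)) (x : Fin n → H) :
    algPerm π (AlgTensorPower.tprod x) = AlgTensorPower.tprod (fun i => x (π i)) :=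
  PiTensorProduct.reindex_tprod _ _

/-- The unitary operator `U^{⊗n}` on `H^{⊗n}`: `U^{⊗n}(x₁ ⊗ ⋯ ⊗ xₙ) = Ux₁ ⊗ ⋯ ⊗ Uxₙ`. -/
def map (U : H ≃ₗᵢ[ℂ] H) (n : ℕ) : HilbertTensorPower H n ≃ₗᵢ[ℂ] HilbertTensorPower H n :=
  extend (algMap U n) (norm_eq_of_form_eq (algMap U n).toLinearMap fun x y => by
    simp [algMap_tprod, AlgTensorPower.form_tprod])

theorem map_tprod (U : H ≃ₗᵢ[ℂ] H) (x : Fin n → H) :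
    map U n (tprod x) = tprod (fun i => U (x i)) := by
  rw [map, tprod, extend_coe, algMap_tprod, tprod]

/-- The operator `U_π` on `H^{⊗n}`: `U_π(x₁ ⊗ ⋯ ⊗ xₙ) = x_{π(1)} ⊗ ⋯ ⊗ x_{π(n)}`. -/
def perm (π : Equiv.Perm (Fin n)) : HilbertTensorPower H n ≃ₗᵢ[ℂ] HilbertTensorPower H n :=
  extend (algPerm π) (norm_eq_of_form_eq (algPerm π).toLinearMap fun x y => by
    simp only [LinearEquiv.coe_coe, algPerm_tprod, AlgTensorPower.form_tprod]
    exact Equiv.prod_comp π fun i => inner ℂ (x i) (y i))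

theorem perm_tprod (π : Equiv.Perm (Fin n)) (x : Fin n → H) :
    perm π (tprod x) = tprod (fun i => x (π i)) := by
  rw [perm, tprod, extend_coe, algPerm_tprod, tprod]

theorem map_perm (U : H ≃ₗᵢ[ℂ] H) (π : Equiv.Perm (Fin n)) (x : HilbertTensorPower H n) :
    map U n (perm π x) = perm π (map U n x) := by
  induction x using UniformSpace.Completion.induction_on with
  | hp => exact isClosed_eq (by fun_prop) (by fun_prop)
  | ih x =>
    have h : (algMap U n).toLinearMap.comp (algPerm π).toLinearMap =
        (algPerm π).toLinearMap.comp (algMap U n).toLinearMap :=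
      LinearMap.ext_on_range (v := AlgTensorPower.tprod) AlgTensorPower.span_range_tprod
        fun y => by simp [algMap_tprod, algPerm_tprod]
    have hx : algMap U n (algPerm π x) = algPerm π (algMap U n x) := LinearMap.congr_fun h x
    simp only [map, perm, extend_coe, hx]

end HilbertTensorPower

/-- The symmetric tensor power `H^{⊙n}`: the elements of `H^{⊗n}` invariant under all `U_π`. -/
def symTensorPower : Submodule ℂ (HilbertTensorPower H n) where
  carrier := {x | ∀ π : Equiv.Perm (Fin n), HilbertTensorPower.perm π x = x}
  add_mem' hx hy π := by rw [map_add, hx π, hy π]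
  zero_mem' π := map_zero _
  smul_mem' c x hx π := by rw [map_smul, hx π]

variable {H} in
/-- The unitary operator `U^{⊙n}`, the restriction of `U^{⊗n}` to `H^{⊙n}`. -/
def symMap (U : H ≃ₗᵢ[ℂ] H) : symTensorPower H n ≃ₗᵢ[ℂ] symTensorPower H n where
  toFun x := ⟨HilbertTensorPower.map U n x, fun π => by
    rw [← HilbertTensorPower.map_perm, x.2 π]⟩
  invFun x := ⟨(HilbertTensorPower.map U n).symm x, fun π => by
    rw [LinearIsometryEquiv.eq_symm_apply, HilbertTensorPower.map_perm,
      LinearIsometryEquiv.apply_symm_apply, x.2 π]⟩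
  map_add' x y := by ext; simp
  map_smul' c x := by ext; simp
  left_inv x := by ext; simp
  right_inv x := by ext; simp
  norm_map' x := (HilbertTensorPower.map U n).norm_map x

end TensorPower

/-! ### Spectral theory of a unitary operator -/

section Spectral

variable {H : Type*} [NormedAddCommGroup H] [InnerProductSpace ℂ H]

/-- The cyclic space generated by `x`: the closed linear span of `Uⁿx`, `n ∈ ℤ`. -/
def cyclicSpace (U : H ≃ₗᵢ[ℂ] H) (x : H) : Submodule ℂ H :=
  (Submodule.span ℂ (Set.range fun n : ℤ => (U ^ n) x)).topologicalClosure

/-- `μ` is the spectral measure of `x`: the finite Borel measure on the circle with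
`⟨Uⁿx, x⟩ = ∫ zⁿ dμ(z)` for all `n ∈ ℤ`. The inner product of Mathlib is linear in its second
argument. -/
structure IsSpectralMeasure (U : H ≃ₗᵢ[ℂ] H) (x : H) (μ : Measure Circle) : Prop where
  finite : IsFiniteMeasure μ
  inner_eq : ∀ n : ℤ, inner ℂ x ((U ^ n) x) = ∫ z : Circle, ((z ^ n : Circle) : ℂ) ∂μ

/-- A spectral decomposition of `U`: `H` is the Hilbert sum of the cyclic spaces of the `x n`, and
the spectral measures `μ n` of the `x n` satisfy `μ 0 ≫ μ 1 ≫ ⋯`. The class of `μ 0` is then the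
maximal spectral type of `U`. -/
structure IsSpectralDecomposition (U : H ≃ₗᵢ[ℂ] H) (x : ℕ → H) (μ : ℕ → Measure Circle) :
    Prop where
  isSpectralMeasure : ∀ n, IsSpectralMeasure U (x n) (μ n)
  orthogonal : Pairwise fun i j => cyclicSpace U (x i) ⟂ cyclicSpace U (x j)
  dense : (⨆ n, cyclicSpace U (x n)).topologicalClosure = ⊤
  absolutelyContinuous : ∀ n, μ (n + 1) ≪ μ n

/-- The spectral multiplicity function `z ↦ ∑ₙ 1_{Aₙ}(z)`, where `Aₙ` is the set on which the
Radon-Nikodym derivative of `μ n` with respect to `μ 0` does not vanish. -/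
def spectralMultiplicity (μ : ℕ → Measure Circle) (z : Circle) : ℕ∞ :=
  {n : ℕ | (μ n).rnDeriv (μ 0) z ≠ 0}.encard

/-- `U` has homogeneous spectrum of multiplicity `N`: the spectral multiplicity function is equal
to `N` almost everywhere with respect to the maximal spectral type. -/
def HasHomogeneousSpectrum (U : H ≃ₗᵢ[ℂ] H) (N : ℕ) : Prop :=
  ∃ (x : ℕ → H) (μ : ℕ → Measure Circle), IsSpectralDecomposition U x μ ∧
    ∀ᵐ z ∂(μ 0), spectralMultiplicity μ z = N

/-- `U` has simple spectrum: homogeneous spectrum of multiplicity one. -/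
def HasSimpleSpectrum (U : H ≃ₗᵢ[ℂ] H) : Prop :=
  HasHomogeneousSpectrum U 1

end Spectral

/-! ### The multiplication operator -/

section Multiplication

variable (σ : Measure Circle)

theorem memLp_circle_mul {g : Circle → Circle} (hg : Continuous g) {f : Circle → ℂ}
    (hf : MemLp f 2 σ) : MemLp (fun z => (g z : ℂ) * f z) 2 σ := by
  refine hf.of_le ?_ (ae_of_all _ fun z => by simp [Circle.norm_coe])
  exact (continuous_subtype_val.comp hg).aestronglyMeasurable.mul hf.1

/-- Multiplication by a continuous circle valued function on `L²(𝕋, σ)`. -/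
def mulCircle (g : C(Circle, Circle)) : Lp ℂ 2 σ →ₗᵢ[ℂ] Lp ℂ 2 σ where
  toFun f := (memLp_circle_mul σ g.continuous (Lp.memLp f)).toLp _
  map_add' f f' := by
    rw [← MemLp.toLp_add]
    refine MemLp.toLp_congr _ _ ?_
    filter_upwards [Lp.coeFn_add f f'] with z hz
    rw [hz]
    exact mul_add _ _ _
  map_smul' c f := by
    rw [RingHom.id_apply, ← MemLp.toLp_const_smul]
    refine MemLp.toLp_congr _ _ ?_
    filter_upwards [Lp.coeFn_smul c f] with z hz
    simp [hz, mul_left_comm]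
  norm_map' f := by
    refine le_antisymm ?_ ?_
    · refine Lp.norm_le_norm_of_ae_le ?_
      filter_upwards [(memLp_circle_mul σ g.continuous (Lp.memLp f)).coeFn_toLp] with z hz
      exact (by simp [hz, Circle.norm_coe] : _ = _).le
    · refine Lp.norm_le_norm_of_ae_le ?_
      filter_upwards [(memLp_circle_mul σ g.continuous (Lp.memLp f)).coeFn_toLp] with z hz
      exact (by simp [hz, Circle.norm_coe] : _ = _).le

theorem coeFn_mulCircle (g : C(Circle, Circle)) (f : Lp ℂ 2 σ) :
    ∀ᵐ z ∂σ, mulCircle σ g f z = (g z : ℂ) * f z :=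
  (memLp_circle_mul σ g.continuous (Lp.memLp f)).coeFn_toLp

/-- The unitary operator `V_σ` on `L²(𝕋, σ)`: `(V_σ f)(z) = z f(z)`. -/
def mulOp : Lp ℂ 2 σ ≃ₗᵢ[ℂ] Lp ℂ 2 σ where
  toFun := mulCircle σ ⟨fun z => z, continuous_id⟩
  invFun := mulCircle σ ⟨fun z => z⁻¹, continuous_inv⟩
  map_add' := map_add _
  map_smul' := map_smul _
  left_inv f := by
    refine Lp.ext ?_
    filter_upwards [coeFn_mulCircle σ ⟨fun z => z, continuous_id⟩ f,
      coeFn_mulCircle σ ⟨fun z => z⁻¹, continuous_inv⟩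
        (mulCircle σ ⟨fun z => z, continuous_id⟩ f)] with z h1 h2
    rw [h2, h1]
    simp
  right_inv f := by
    refine Lp.ext ?_
    filter_upwards [coeFn_mulCircle σ ⟨fun z => z⁻¹, continuous_inv⟩ f,
      coeFn_mulCircle σ ⟨fun z => z, continuous_id⟩
        (mulCircle σ ⟨fun z => z⁻¹, continuous_inv⟩ f)] with z h1 h2
    rw [h2, h1]
    simp
  norm_map' := (mulCircle σ ⟨fun z => z, continuous_id⟩).norm_map

theorem coeFn_mulOp (f : Lp ℂ 2 σ) : ∀ᵐ z ∂σ, mulOp σ f z = (z : ℂ) * f z :=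
  coeFn_mulCircle σ ⟨fun z => z, continuous_id⟩ f

end Multiplication

end

/-!
If `V_σ^{⊙n}` has simple spectrum, then it has a cyclic vector. Viewed in `L²(σⁿ)`, all elements of
its cyclic space are multiples of it by functions of the product `z₁ ⋯ zₙ`, and comparing
`f ⊗ ⋯ ⊗ f` with `1 ⊗ ⋯ ⊗ 1` shows that `f(z₁) ⋯ f(zₙ)` is almost everywhere a function of
`z₁ ⋯ zₙ`. For nonvanishing `f`, freezing some of the variables gives the same for all `m ≤ n`.
Applied to `f(z) = t - z` for all integers `t ≥ 2`, this says that `z₁ ⋯ zₘ` almost everywhere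
determines the polynomial with roots `z₁, …, zₘ`, hence the multiset of the `zᵢ`.

With `m = k` and `m = 2k` we obtain `k`-element multisets `R(s)` with product `s`, for
`σ^{∗k}`-almost every `s`, such that `R(s) + R(t)` is a function of `st`. If `σ^{∗k}` were not
singular to `ν₁ ∗ ⋯ ∗ νₖ₊₁`, one could choose three distinct points `wᵢ(0)`, `wᵢ(1)`, `wᵢ(2)` for
each `i ≤ k + 1` such that this applies to all the products of the `wᵢ(cᵢ)`. Exchanging a
coordinate between two everywhere different choices `c` and `d` does not affect the product of the
two products. Therefore the change from `wᵢ(0)` to `wᵢ(1)` affects the multiset independently of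
the other coordinates. It removes some element, and removing `k + 1` elements from a `k`-element
multiset is impossible.
-/

open Filter Topology
open scoped ENNReal

section CyclicVector

variable {H : Type*} [NormedAddCommGroup H] [InnerProductSpace ℂ H] {U : H ≃ₗᵢ[ℂ] H}

theorem IsSpectralMeasure.eq_zero {x : H} (h : IsSpectralMeasure U x 0) : x = 0 := by
  simpa using h.inner_eq 0

theorem cyclicSpace_zero (U : H ≃ₗᵢ[ℂ] H) : cyclicSpace U 0 = ⊥ := by
  have hspan : Submodule.span ℂ (Set.range fun n : ℤ => (U ^ n) (0 : H)) = ⊥ := by simp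
  rw [cyclicSpace, hspan]
  exact isClosed_singleton.submodule_topologicalClosure_eq

theorem cyclicSpace_le_of_isClosed {W : Submodule ℂ H} (hW : IsClosed (W : Set H))
    (hU : ∀ y, U y ∈ W ↔ y ∈ W) {x : H} (hx : x ∈ W) : cyclicSpace U x ≤ W := by
  refine Submodule.topologicalClosure_minimal _ (Submodule.span_le.2 ?_) hW
  rintro _ ⟨n, rfl⟩
  change (U ^ n) x ∈ W
  induction n using Int.induction_on with
  | zero => simpa using hx
  | succ n ih =>
    rw [add_comm, zpow_one_add]
    exact (hU _).2 ih
  | pred n ih =>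
    refine (hU _).1 ?_
    change (U * U ^ (-(n : ℤ) - 1)) x ∈ W
    rwa [← zpow_one_add, add_sub_cancel]

theorem IsSpectralDecomposition.absolutelyContinuous_zero {x : ℕ → H} {μ : ℕ → Measure Circle}
    (hd : IsSpectralDecomposition U x μ) (n : ℕ) : μ n ≪ μ 0 := by
  induction n with
  | zero => exact Measure.AbsolutelyContinuous.rfl
  | succ n ih => exact (hd.absolutelyContinuous n).trans ih

theorem IsSpectralDecomposition.eq_zero_of_spectralMultiplicity_eq_one {x : ℕ → H}
    {μ : ℕ → Measure Circle} (hd : IsSpectralDecomposition U x μ)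
    (hm : ∀ᵐ z ∂(μ 0), spectralMultiplicity μ z = 1) {n : ℕ} (hn : n ≠ 0) : x n = 0 := by
  have hfin (m : ℕ) : IsFiniteMeasure (μ m) := (hd.isSpectralMeasure m).finite
  have hderiv : (μ n).rnDeriv (μ 0) =ᵐ[μ 0] 0 := by
    filter_upwards [hm, (μ 0).rnDeriv_self] with z hz h0
    by_contra hne
    have hsub := Set.encard_le_one_iff.1 hz.le
    exact hn (hsub n 0 hne (by simp [h0]))
  have hμ : μ n = 0 := by
    rw [← Measure.withDensity_rnDeriv_eq _ _ (hd.absolutelyContinuous_zero n),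
      withDensity_congr_ae hderiv, withDensity_zero]
  exact (hμ ▸ hd.isSpectralMeasure n).eq_zero

theorem HasSimpleSpectrum.exists_cyclicSpace_eq_top (h : HasSimpleSpectrum U) :
    ∃ x, cyclicSpace U x = ⊤ := by
  obtain ⟨x, μ, hd, hm⟩ := h
  refine ⟨x 0, ?_⟩
  have hsup : (⨆ n, cyclicSpace U (x n)) = cyclicSpace U (x 0) := by
    refine le_antisymm (iSup_le fun n => ?_) (le_iSup (fun n => cyclicSpace U (x n)) 0)
    rcases eq_or_ne n 0 with rfl | hn
    · exact le_rfl
    · rw [hd.eq_zero_of_spectralMultiplicity_eq_one (by exact_mod_cast hm) hn, cyclicSpace_zero]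
      exact bot_le
  rw [← hd.dense, hsup]
  exact (Submodule.isClosed_topologicalClosure _).submodule_topologicalClosure_eq.symm

end CyclicVector

section UniversalProperty

variable {H E : Type*} [NormedAddCommGroup H] [InnerProductSpace ℂ H]
  [NormedAddCommGroup E] [InnerProductSpace ℂ E] {n : ℕ}

theorem HilbertTensorPower.continuousLinearMap_ext
    {f g : HilbertTensorPower H n →L[ℂ] E} (h : ∀ x, f (tprod x) = g (tprod x)) : f = g := by
  refine ContinuousLinearMap.ext fun y => ?_
  induction y using UniformSpace.Completion.induction_on with
  | hp => exact isClosed_eq f.continuous g.continuous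
  | ih y =>
    let ι : AlgTensorPower H n →L[ℂ] HilbertTensorPower H n := UniformSpace.Completion.toComplL
    have hι : (f ∘L ι : AlgTensorPower H n →ₗ[ℂ] E) = (g ∘L ι : AlgTensorPower H n →L[ℂ] E) :=
      LinearMap.ext_on_range AlgTensorPower.span_range_tprod h
    exact LinearMap.congr_fun hι y

/-- The linear map on the algebraic tensor power induced by a multilinear map. -/
noncomputable def AlgTensorPower.lift (f : MultilinearMap ℂ (fun _ : Fin n => H) E) :
    AlgTensorPower H n →ₗ[ℂ] E :=
  PiTensorProduct.lift f

theorem AlgTensorPower.lift_tprod (f : MultilinearMap ℂ (fun _ : Fin n => H) E) (x : Fin n → H) :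
    lift f (tprod x) = f x :=
  PiTensorProduct.lift.tprod x

theorem AlgTensorPower.inner_lift {f : MultilinearMap ℂ (fun _ : Fin n => H) E}
    (hf : ∀ x y, inner ℂ (f x) (f y) = ∏ i, inner ℂ (x i) (y i)) (u v : AlgTensorPower H n) :
    inner ℂ (lift f u) (lift f v) = inner ℂ u v := by
  have hforms : ((innerₛₗ ℂ).comp (lift f)).compl₂ (lift f) =
      (innerₛₗ ℂ : AlgTensorPower H n →ₗ⋆[ℂ] AlgTensorPower H n →ₗ[ℂ] ℂ) := by
    refine LinearMap.ext_on_range span_range_tprod fun x => ?_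
    refine LinearMap.ext_on_range span_range_tprod fun y => ?_
    simp [lift_tprod, hf, inner_tprod]
  exact LinearMap.congr_fun (LinearMap.congr_fun hforms u) v

variable [CompleteSpace E]

/-- The map on `H^{⊗n}` induced by a multilinear map `f`; it is a bounded extension of `f` as soon
as `f` multiplies inner products. -/
noncomputable def HilbertTensorPower.lift (f : MultilinearMap ℂ (fun _ : Fin n => H) E) :
    HilbertTensorPower H n →L[ℂ] E :=
  (AlgTensorPower.lift f).extendOfNorm
    (UniformSpace.Completion.toComplL : AlgTensorPower H n →L[ℂ] HilbertTensorPower H n)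

theorem HilbertTensorPower.lift_tprod {f : MultilinearMap ℂ (fun _ : Fin n => H) E}
    (hf : ∀ x y, inner ℂ (f x) (f y) = ∏ i, inner ℂ (x i) (y i)) (x : Fin n → H) :
    lift f (tprod x) = f x := by
  rw [← AlgTensorPower.lift_tprod]
  refine LinearMap.extendOfNorm_eq UniformSpace.Completion.denseRange_coe ⟨1, fun u => ?_⟩ _
  have hnorm := (AlgTensorPower.lift f).isometryOfInner (AlgTensorPower.inner_lift hf) |>.norm_map u
  simpa using hnorm.le

end UniversalProperty

section ProductMeasure

variable {ι : Type*} [Fintype ι] {X : ι → Type*} [∀ i, MeasurableSpace (X i)]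
  {μ : ∀ i, Measure (X i)} [∀ i, SigmaFinite (μ i)]

theorem measure_pi_eq_zero_iff : Measure.pi μ = 0 ↔ ∃ i, μ i = 0 := by
  simp only [← Measure.measure_univ_eq_zero, Measure.pi_univ, Finset.prod_eq_zero_iff,
    Finset.mem_univ, true_and]

theorem ae_pi_forall_eval {p : ∀ i, X i → Prop} (h : ∀ i, ∀ᵐ x ∂μ i, p i x) :
    ∀ᵐ z ∂Measure.pi μ, ∀ i, p i (z i) :=
  ae_all_iff.2 fun i => (Measure.quasiMeasurePreserving_eval μ i).ae (h i)

theorem measurePreserving_finAppend {X : Type*} [MeasurableSpace X] (σ : Measure X) [SigmaFinite σ]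
    (l m : ℕ) :
    MeasurePreserving (fun w : (Fin l → X) × (Fin m → X) => Fin.append w.1 w.2)
      ((Measure.pi fun _ => σ).prod (Measure.pi fun _ => σ))
      (Measure.pi fun _ : Fin (l + m) => σ) := by
  have hsum := measurePreserving_sumPiEquivProdPi_symm (fun _ : Fin l ⊕ Fin m => σ)
  have hcongr := measurePreserving_piCongrLeft (fun _ : Fin (l + m) => σ) finSumFinEquiv
  convert hcongr.comp hsum using 1
  funext w i
  obtain ⟨j, rfl⟩ := finSumFinEquiv.surjective i
  refine Eq.trans ?_ (Equiv.piCongrLeft_apply_apply (fun _ => X) finSumFinEquiv _ j).symm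
  cases j with
  | inl j => exact Fin.append_left _ _ j
  | inr j => exact Fin.append_right _ _ j

end ProductMeasure

section ProductOfL2

variable {𝕜 : Type*} [RCLike 𝕜] {ι : Type*} [Fintype ι] {X : ι → Type*} [∀ i, MeasurableSpace (X i)]
  (μ : ∀ i, Measure (X i)) [∀ i, SigmaFinite (μ i)]

theorem memLp_two_pi_prod {f : ∀ i, X i → 𝕜} (hf : ∀ i, MemLp (f i) 2 (μ i)) :
    MemLp (fun z : ∀ i, X i => ∏ i, f i (z i)) 2 (Measure.pi μ) := by
  have hmeas : AEStronglyMeasurable (fun z : ∀ i, X i => ∏ i, f i (z i)) (Measure.pi μ) :=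
    Finset.aestronglyMeasurable_fun_prod _ fun i _ =>
      (hf i).1.comp_quasiMeasurePreserving (Measure.quasiMeasurePreserving_eval μ i)
  rw [memLp_two_iff_integrable_sq_norm hmeas]
  simpa only [norm_prod, Finset.prod_pow] using Integrable.fintype_prod_dep
    (f := fun i x => ‖f i x‖ ^ 2) fun i => (memLp_two_iff_integrable_sq_norm (hf i).1).1 (hf i)

variable (𝕜) in
/-- The map `(f₁, …, fₙ) ↦ f₁(z₁) ⋯ fₙ(zₙ)` from square integrable functions to square integrable
functions of the product measure. -/
noncomputable def lpProd : MultilinearMap 𝕜 (fun i => Lp 𝕜 2 (μ i)) (Lp 𝕜 2 (Measure.pi μ)) where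
  toFun f := (memLp_two_pi_prod μ fun i => Lp.memLp (f i)).toLp _
  map_update_add' m i a b := by
    rw [← MemLp.toLp_add]
    refine MemLp.toLp_congr _ _ ?_
    filter_upwards [(Measure.quasiMeasurePreserving_eval μ i).ae (Lp.coeFn_add a b)] with z hz
    simp only [Function.apply_update (fun (j : ι) (c : Lp 𝕜 2 (μ j)) => c (z j)), hz,
      Pi.add_apply]
    simp [Finset.prod_update_of_mem, add_mul]
  map_update_smul' m i c a := by
    rw [← MemLp.toLp_const_smul]
    refine MemLp.toLp_congr _ _ ?_
    filter_upwards [(Measure.quasiMeasurePreserving_eval μ i).ae (Lp.coeFn_smul c a)] with z hz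
    simp only [Function.apply_update (fun (j : ι) (c : Lp 𝕜 2 (μ j)) => c (z j)), hz,
      Pi.smul_apply]
    simp [Finset.prod_update_of_mem, mul_assoc]

theorem coeFn_lpProd (f : ∀ i, Lp 𝕜 2 (μ i)) :
    lpProd 𝕜 μ f =ᵐ[Measure.pi μ] fun z => ∏ i, f i (z i) :=
  (memLp_two_pi_prod μ fun i => Lp.memLp (f i)).coeFn_toLp

theorem inner_lpProd (f g : ∀ i, Lp 𝕜 2 (μ i)) :
    inner 𝕜 (lpProd 𝕜 μ f) (lpProd 𝕜 μ g) = ∏ i, inner 𝕜 (f i) (g i) := by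
  simp only [L2.inner_def]
  rw [← integral_fintype_prod_eq_prod]
  refine integral_congr_ae ?_
  filter_upwards [coeFn_lpProd μ f, coeFn_lpProd μ g] with z hf hg
  simp [hf, hg, Finset.prod_mul_distrib]

end ProductOfL2

section MultiplicationOperator

variable {Ω 𝕜 : Type*} [MeasurableSpace Ω] {μ : Measure Ω} [RCLike 𝕜] {p : ℝ≥0∞} [Fact (1 ≤ p)]

theorem exists_continuousLinearMap_coeFn_eq_mul {c : Ω → 𝕜} (hc : MemLp c ∞ μ) :
    ∃ M : Lp 𝕜 p μ →L[𝕜] Lp 𝕜 p μ, ∀ g, M g =ᵐ[μ] fun z => c z * g z := by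
  refine ⟨(ContinuousLinearMap.mul 𝕜 𝕜).holderL μ ∞ p p (hc.toLp c), fun g => ?_⟩
  filter_upwards [(ContinuousLinearMap.mul 𝕜 𝕜).coeFn_holder (r := p) (hc.toLp c) g, hc.coeFn_toLp]
    with z hz hcz
  rw [ContinuousLinearMap.holderL_apply_apply, hz, hcz, ContinuousLinearMap.mul_apply']

end MultiplicationOperator

section Intertwining

variable (σ : Measure Circle) [IsFiniteMeasure σ] {n : ℕ}

/-- The map `L²(σ)^{⊗n} → L²(σ^n)` with `f₁ ⊗ ⋯ ⊗ fₙ ↦ f₁(z₁) ⋯ fₙ(zₙ)`. -/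
noncomputable def lpPi :
    HilbertTensorPower (Lp ℂ 2 σ) n →L[ℂ] Lp ℂ 2 (Measure.pi fun _ : Fin n => σ) :=
  HilbertTensorPower.lift (lpProd ℂ fun _ => σ)

theorem lpPi_tprod (f : Fin n → Lp ℂ 2 σ) :
    lpPi σ (HilbertTensorPower.tprod f) = lpProd ℂ (fun _ => σ) f :=
  HilbertTensorPower.lift_tprod (inner_lpProd fun _ => σ) f

theorem lpPi_map_mulOp (y : HilbertTensorPower (Lp ℂ 2 σ) n) :
    lpPi σ (HilbertTensorPower.map (mulOp σ) n y) =ᵐ[Measure.pi fun _ : Fin n => σ]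
      fun z => ((∏ i, z i : Circle) : ℂ) * lpPi σ y z := by
  have hc : MemLp (fun z : Fin n → Circle => ((∏ i, z i : Circle) : ℂ)) ∞
      (Measure.pi fun _ : Fin n => σ) :=
    Continuous.memLp_of_hasCompactSupport (by fun_prop) (.of_compactSpace _)
  obtain ⟨M, hM⟩ := exists_continuousLinearMap_coeFn_eq_mul (p := 2) hc
  let V : HilbertTensorPower (Lp ℂ 2 σ) n →L[ℂ] HilbertTensorPower (Lp ℂ 2 σ) n :=
    (HilbertTensorPower.map (mulOp σ) n).toContinuousLinearEquiv
  have hext : (lpPi σ).comp V = M.comp (lpPi σ) := by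
    refine HilbertTensorPower.continuousLinearMap_ext fun f => Lp.ext ?_
    change lpPi σ (HilbertTensorPower.map (mulOp σ) n (HilbertTensorPower.tprod f)) =ᵐ[_]
      M (lpPi σ (HilbertTensorPower.tprod f))
    rw [HilbertTensorPower.map_tprod, lpPi_tprod, lpPi_tprod]
    filter_upwards [coeFn_lpProd _ f, coeFn_lpProd _ fun i => mulOp σ (f i),
      hM (lpProd ℂ (fun _ => σ) f), ae_pi_forall_eval fun i => coeFn_mulOp σ (f i)]
      with z hf hVf hMf hV
    simp only [hVf, hMf, hf, hV, Finset.prod_mul_distrib]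
    congr 1
    exact (map_prod Circle.coeHom _ _).symm
  exact (Lp.ext_iff.1 (DFunLike.congr_fun hext y)).trans (hM _)

end Intertwining

section ComapMultiples

variable {Ω Y 𝕜 : Type*} [MeasurableSpace Ω] [MeasurableSpace Y] {μ : Measure Ω} [RCLike 𝕜]
  {p : ℝ≥0∞}

theorem exists_eq_comp_mul_of_tendsto_ae {π : Ω → Y} {X g : Ω → 𝕜} {f : ℕ → Ω → 𝕜}
    (hf : ∀ m, ∃ q : Y → 𝕜, StronglyMeasurable q ∧ f m =ᵐ[μ] fun z => q (π z) * X z)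
    (hg : ∀ᵐ z ∂μ, Tendsto (fun m => f m z) atTop (𝓝 (g z))) :
    ∃ q : Y → 𝕜, StronglyMeasurable q ∧ g =ᵐ[μ] fun z => q (π z) * X z := by
  choose q hq hqf using hf
  refine ⟨_, StronglyMeasurable.limUnder (l := atTop) hq, ?_⟩
  filter_upwards [hg, ae_all_iff.2 hqf] with z hz hqz
  simp only [hqz] at hz
  by_cases hX : X z = 0
  · simp only [hX, mul_zero] at hz ⊢
    exact tendsto_nhds_unique hz tendsto_const_nhds
  · have hlim : Tendsto (fun m => q m (π z)) atTop (𝓝 (g z * (X z)⁻¹)) := by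
      simpa only [mul_inv_cancel_right₀ hX] using hz.mul_const (X z)⁻¹
    rw [hlim.limUnder_eq, inv_mul_cancel_right₀ hX]

/-- The space of the functions in `Lᵖ` that are of the form `z ↦ q (π z) * X z`. -/
def comapMultiples (π : Ω → Y) (X : Ω → 𝕜) (p : ℝ≥0∞) (μ : Measure Ω) :
    Submodule 𝕜 (Lp 𝕜 p μ) where
  carrier := {g | ∃ q : Y → 𝕜, StronglyMeasurable q ∧ g =ᵐ[μ] fun z => q (π z) * X z}
  add_mem' := by
    rintro g g' ⟨q, hq, hg⟩ ⟨q', hq', hg'⟩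
    refine ⟨q + q', hq.add hq', ?_⟩
    filter_upwards [hg, hg', Lp.coeFn_add g g'] with z h h' hadd
    rw [hadd, Pi.add_apply, Pi.add_apply, h, h', add_mul]
  zero_mem' := ⟨0, stronglyMeasurable_zero, by
    filter_upwards [Lp.coeFn_zero 𝕜 p μ] with z hz
    rw [hz, Pi.zero_apply, Pi.zero_apply, zero_mul]⟩
  smul_mem' := by
    rintro c g ⟨q, hq, hg⟩
    refine ⟨c • q, hq.const_smul c, ?_⟩
    filter_upwards [hg, Lp.coeFn_smul c g] with z h hsmul
    rw [hsmul, Pi.smul_apply, Pi.smul_apply, h, smul_mul_assoc]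

theorem isClosed_comapMultiples [Fact (1 ≤ p)] (π : Ω → Y) (X : Ω → 𝕜) :
    IsClosed (comapMultiples π X p μ : Set (Lp 𝕜 p μ)) := by
  refine IsSeqClosed.isClosed fun f g hf hg => ?_
  obtain ⟨a, -, ha⟩ := (tendstoInMeasure_of_tendsto_Lp hg).exists_seq_tendsto_ae
  exact exists_eq_comp_mul_of_tendsto_ae (fun m => hf (a m)) ha

theorem mem_comapMultiples_iff_of_ae_eq_mul {π : Ω → Y} {X : Ω → 𝕜} {e : Y → 𝕜}
    (he : Measurable e) (he0 : ∀ s, e s ≠ 0) {f g : Lp 𝕜 p μ}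
    (hfg : f =ᵐ[μ] fun z => e (π z) * g z) :
    f ∈ comapMultiples π X p μ ↔ g ∈ comapMultiples π X p μ := by
  constructor
  · rintro ⟨q, hq, hf⟩
    refine ⟨fun s => (e s)⁻¹ * q s, he.inv.stronglyMeasurable.mul hq, ?_⟩
    filter_upwards [hf, hfg] with z h h'
    rw [mul_assoc, ← h, h', inv_mul_cancel_left₀ (he0 _)]
  · rintro ⟨q, hq, hg⟩
    refine ⟨fun s => e s * q s, he.stronglyMeasurable.mul hq, ?_⟩
    filter_upwards [hg, hfg] with z h h'
    rw [mul_assoc, ← h, h']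

end ComapMultiples

section FactorsThroughProd

/-- For almost all `(z₁, …, zₙ)`, the product `f(z₁) ⋯ f(zₙ)` is a measurable function of
`z₁ ⋯ zₙ`. -/
def FactorsThroughProd {G M : Type*} [MeasurableSpace G] [MeasurableSpace M] [CommMonoid G]
    [CommMonoid M] (σ : Measure G) (n : ℕ) (f : G → M) : Prop :=
  ∃ q : G → M, Measurable q ∧
    ∀ᵐ z ∂(Measure.pi fun _ : Fin n => σ), ∏ i, f (z i) = q (∏ i, z i)

theorem mem_comapMultiples_of_cyclicSpace_eq_top (σ : Measure Circle) [IsFiniteMeasure σ] {n : ℕ}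
    {x : symTensorPower (Lp ℂ 2 σ) n} (hx : cyclicSpace (symMap n (mulOp σ)) x = ⊤)
    (y : symTensorPower (Lp ℂ 2 σ) n) :
    lpPi σ (y : HilbertTensorPower (Lp ℂ 2 σ) n) ∈
      comapMultiples (fun z : Fin n → Circle => ∏ i, z i) (lpPi σ x.1) 2
        (Measure.pi fun _ => σ) := by
  let L : symTensorPower (Lp ℂ 2 σ) n →L[ℂ] Lp ℂ 2 (Measure.pi fun _ : Fin n => σ) :=
    (lpPi σ).comp (symTensorPower (Lp ℂ 2 σ) n).subtypeL
  let W := (comapMultiples (fun z : Fin n → Circle => ∏ i, z i) (L x) 2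
    (Measure.pi fun _ => σ)).comap L.toLinearMap
  have hW : IsClosed (W : Set (symTensorPower (Lp ℂ 2 σ) n)) :=
    (isClosed_comapMultiples _ _).preimage L.continuous
  have hcoe : Measurable fun s : Circle => (s : ℂ) :=
    (by fun_prop : Continuous fun s : Circle => (s : ℂ)).measurable
  have hinv (y) : symMap n (mulOp σ) y ∈ W ↔ y ∈ W :=
    mem_comapMultiples_iff_of_ae_eq_mul hcoe Circle.coe_ne_zero (lpPi_map_mulOp σ y.1)
  have hxW : x ∈ W := ⟨1, stronglyMeasurable_one, by simp [L]⟩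
  exact cyclicSpace_le_of_isClosed hW hinv hxW (hx ▸ Submodule.mem_top : y ∈ cyclicSpace _ x)

theorem HasSimpleSpectrum.factorsThroughProd {σ : Measure Circle} [IsFiniteMeasure σ] {n : ℕ}
    (h : HasSimpleSpectrum (symMap n (mulOp σ))) {f : Circle → ℂ} (hf : MemLp f 2 σ) :
    FactorsThroughProd σ n f := by
  obtain ⟨x, hx⟩ := h.exists_cyclicSpace_eq_top
  have hmultiple {g : Circle → ℂ} (hg : MemLp g 2 σ) : ∃ q : Circle → ℂ, Measurable q ∧
      ∀ᵐ z ∂(Measure.pi fun _ : Fin n => σ), ∏ i, g (z i) = q (∏ i, z i) * lpPi σ x.1 z := by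
    obtain ⟨q, hq, hqy⟩ := mem_comapMultiples_of_cyclicSpace_eq_top σ hx
      ⟨HilbertTensorPower.tprod fun _ => hg.toLp g, fun π => by
        rw [HilbertTensorPower.perm_tprod]⟩
    refine ⟨q, hq.measurable, ?_⟩
    rw [lpPi_tprod] at hqy
    filter_upwards [hqy, coeFn_lpProd (fun _ => σ) fun _ : Fin n => hg.toLp g,
      ae_pi_forall_eval fun _ => hg.coeFn_toLp] with z hz hprod hg
    rw [← hz, hprod, Finset.prod_congr rfl fun i _ => hg i]
  -- The constant function `1` shows that the cyclic vector is itself a function of the product.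
  obtain ⟨q₁, hq₁, hone⟩ := hmultiple (memLp_const (1 : ℂ))
  obtain ⟨q, hq, hqf⟩ := hmultiple hf
  refine ⟨fun s => q s * (q₁ s)⁻¹, hq.mul hq₁.inv, ?_⟩
  filter_upwards [hqf, hone] with z hz hz₁
  rw [Finset.prod_const_one] at hz₁
  rw [hz, eq_inv_of_mul_eq_one_right hz₁.symm]

variable {G M : Type*} [MeasurableSpace G] [MeasurableSpace M] [CommMonoid G] [CommMonoid M]
  {σ : Measure G} {n : ℕ}

theorem FactorsThroughProd.pi {J : Type*} [Countable J] {f : G → J → M}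
    (hf : ∀ j, FactorsThroughProd σ n fun z => f z j) : FactorsThroughProd σ n f := by
  choose q hq hqf using hf
  refine ⟨fun s j => q j s, measurable_pi_lambda _ hq, ?_⟩
  filter_upwards [ae_all_iff.2 hqf] with z hz
  funext j
  rw [Finset.prod_apply, hz]

theorem FactorsThroughProd.mono [MeasurableMul G] [MeasurableMul M] [SigmaFinite σ] {m : ℕ}
    {f : G → M} (hunit : ∀ z, IsUnit (f z)) (h : FactorsThroughProd σ m f) (hnm : n ≤ m) :
    FactorsThroughProd σ n f := by
  obtain ⟨l, rfl⟩ := Nat.exists_eq_add_of_le' hnm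
  obtain ⟨q, hq, hqf⟩ := h
  have hsplit : ∀ᵐ y ∂(Measure.pi fun _ : Fin l => σ), ∀ᵐ z ∂(Measure.pi fun _ : Fin n => σ),
      (∏ i, f (y i)) * ∏ i, f (z i) = q ((∏ i, y i) * ∏ i, z i) := by
    have h := Measure.ae_ae_of_ae_prod
      ((measurePreserving_finAppend σ l n).quasiMeasurePreserving.ae hqf)
    simpa only [Fin.prod_univ_add, Fin.append_left, Fin.append_right] using h
  rcases eq_or_ne σ 0 with rfl | hσ
  · refine ⟨1, measurable_one, ?_⟩
    rcases isEmpty_or_nonempty (Fin n) with _ | ⟨⟨i⟩⟩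
    · simp
    · rw [measure_pi_eq_zero_iff.2 ⟨i, rfl⟩]
      exact ae_zero.le trivial
  · have : NeZero σ := ⟨hσ⟩
    have : (ae (Measure.pi fun _ : Fin l => σ)).NeBot :=
      ae_neBot.2 (mt measure_pi_eq_zero_iff.1 (not_exists.2 fun _ => hσ))
    obtain ⟨y, hy⟩ := hsplit.exists
    obtain ⟨u, hu⟩ := IsUnit.prod_univ_iff.2 fun i => hunit (y i)
    refine ⟨fun s => u⁻¹ * q ((∏ i, y i) * s), ?_, ?_⟩
    · exact (hq.comp (measurable_const_mul _)).const_mul _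
    · filter_upwards [hy] with z hz
      rw [← hz, ← hu, Units.inv_mul_cancel_left]

end FactorsThroughProd

section LinearFactors

/-- The values of the polynomial `X - z` at the integers `2, 3, …`. These points lie outside the
unit circle, so that no value vanishes, and there are enough of them to determine the polynomial. -/
noncomputable def linearFactors (z : Circle) : ℕ → ℂ :=
  fun t => t + 2 - z

theorem continuous_linearFactors : Continuous linearFactors := by
  unfold linearFactors
  fun_prop

theorem isUnit_linearFactors (z : Circle) : IsUnit (linearFactors z) := by
  refine Pi.isUnit_iff.2 fun t => isUnit_iff_ne_zero.2 (sub_ne_zero.2 fun h => ?_)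
  have hnorm : (t : ℝ) + 2 = 1 := by
    have hcast : ‖((t + 2 : ℕ) : ℂ)‖ = 1 := by
      push_cast
      rw [h, Circle.norm_coe]
    rw [Complex.norm_natCast] at hcast
    exact_mod_cast hcast
  linarith [t.cast_nonneg (α := ℝ)]

theorem prod_map_linearFactors_injective :
    Function.Injective fun M : Multiset Circle => (M.map linearFactors).prod := by
  let p : Multiset Circle → Polynomial ℂ := fun M =>
    ((M.map fun z : Circle => (z : ℂ)).map fun z => Polynomial.X - Polynomial.C z).prod
  have heval (M : Multiset Circle) (t : ℕ) :
      (p M).eval ((t : ℂ) + 2) = (M.map linearFactors).prod t := by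
    rw [Pi.multiset_prod_apply]
    simp only [p, Polynomial.eval_multiset_prod, Multiset.map_map, Function.comp_def,
      Polynomial.eval_sub, Polynomial.eval_X, Polynomial.eval_C, linearFactors]
  intro M M' h
  have hp : p M = p M' := by
    refine Polynomial.eq_of_infinite_eval_eq _ _ (Set.infinite_of_injective_forall_mem
      (f := fun t : ℕ => (t : ℂ) + 2) (fun a b hab => by simpa using hab) fun t => ?_)
    exact (heval M t).trans ((congrFun h t).trans (heval M' t).symm)
  have hroots := congrArg Polynomial.roots hp
  rw [Polynomial.roots_multiset_prod_X_sub_C, Polynomial.roots_multiset_prod_X_sub_C] at hroots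
  exact Multiset.map_injective Circle.coe_injective hroots

theorem HasSimpleSpectrum.factorsThroughProd_linearFactors {σ : Measure Circle} [IsFiniteMeasure σ]
    {n m : ℕ} (h : HasSimpleSpectrum (symMap n (mulOp σ))) (hmn : m ≤ n) :
    FactorsThroughProd σ m linearFactors := by
  refine (FactorsThroughProd.pi fun t => h.factorsThroughProd ?_).mono isUnit_linearFactors hmn
  have hcont : Continuous fun z => linearFactors z t :=
    (continuous_apply t).comp continuous_linearFactors
  exact hcont.memLp_of_hasCompactSupport (.of_compactSpace _)

end LinearFactors

section Roots

theorem ae_map_exists_eq_of_ae_eq_comp {Ω X Y : Type*} [TopologicalSpace Ω] [CompactSpace Ω]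
    [MeasurableSpace Ω] [BorelSpace Ω] [TopologicalSpace X] [T2Space X] [MeasurableSpace X]
    [BorelSpace X] [SecondCountableTopology X] [TopologicalSpace Y] [T2Space Y] [MeasurableSpace Y]
    [BorelSpace Y]
    {μ : Measure Ω} {π : Ω → X} {f : Ω → Y} {q : X → Y} (hπ : Continuous π) (hf : Continuous f)
    (hq : Measurable q) (h : ∀ᵐ z ∂μ, f z = q (π z)) :
    ∀ᵐ s ∂(μ.map π), ∃ z, π z = s ∧ f z = q s := by
  have hrange : MeasurableSet (Set.range fun z => (π z, f z)) :=
    (isCompact_range (hπ.prodMk hf)).isClosed.measurableSet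
  have hmeas : MeasurableSet {s | ∃ z, π z = s ∧ f z = q s} := by
    convert (measurable_id.prodMk hq) hrange using 1
    simp [Set.preimage]
  rw [ae_map_iff hπ.measurable.aemeasurable hmeas]
  filter_upwards [h] with z hz
  exact ⟨z, rfl, hz⟩

instance isFiniteMeasure_circleConv {n : ℕ} (ν : Fin n → Measure Circle)
    [∀ i, IsFiniteMeasure (ν i)] : IsFiniteMeasure (circleConv ν) := by
  unfold circleConv
  infer_instance

variable {σ : Measure Circle} {k : ℕ}

instance isFiniteMeasure_convPow [IsFiniteMeasure σ] : IsFiniteMeasure (convPow σ k) :=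
  isFiniteMeasure_circleConv _

theorem measurable_circle_prod (n : ℕ) : Measurable fun z : Fin n → Circle => ∏ i, z i :=
  (continuous_finsetProd _ fun i _ => continuous_apply i).measurable

theorem ae_convPow_exists_multiset {M : Type*} [TopologicalSpace M] [T2Space M] [MeasurableSpace M]
    [BorelSpace M] [CommMonoid M] [ContinuousMul M] {f : Circle → M}
    (hf : Continuous f) {a : Circle → M} (ha : Measurable a)
    (hfa : ∀ᵐ z ∂(Measure.pi fun _ : Fin k => σ), ∏ i, f (z i) = a (∏ i, z i)) :
    ∀ᵐ s ∂convPow σ k, ∃ S : Multiset Circle, S.card = k ∧ S.prod = s ∧ (S.map f).prod = a s := by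
  have hF : Continuous fun z : Fin k → Circle => ∏ i, f (z i) :=
    continuous_finsetProd _ fun i _ => hf.comp (continuous_apply i)
  filter_upwards [ae_map_exists_eq_of_ae_eq_comp (by fun_prop) hF ha hfa] with s ⟨z, hz, hzs⟩
  exact ⟨Finset.univ.val.map z, by simp, hz, by rwa [Multiset.map_map]⟩

variable [IsFiniteMeasure σ]

theorem ae_convPow_prod_mul_eq {M : Type*} [MeasurableSpace M] [MeasurableEq M] [CommMonoid M]
    [MeasurableMul₂ M] {f : Circle → M} {l m : ℕ} {a b r : Circle → M} (ha : Measurable a)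
    (hb : Measurable b) (hr : Measurable r)
    (hfa : ∀ᵐ z ∂(Measure.pi fun _ : Fin l => σ), ∏ i, f (z i) = a (∏ i, z i))
    (hfb : ∀ᵐ z ∂(Measure.pi fun _ : Fin m => σ), ∏ i, f (z i) = b (∏ i, z i))
    (hfr : ∀ᵐ z ∂(Measure.pi fun _ : Fin (l + m) => σ), ∏ i, f (z i) = r (∏ i, z i)) :
    ∀ᵐ s ∂(convPow σ l).prod (convPow σ m), a s.1 * b s.2 = r (s.1 * s.2) := by
  have hl := measurable_circle_prod l
  have hm := measurable_circle_prod m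
  have hset : MeasurableSet {s : Circle × Circle | a s.1 * b s.2 = r (s.1 * s.2)} :=
    measurableSet_eq_fun (by fun_prop) (by fun_prop)
  rw [convPow, convPow, circleConv, circleConv, Measure.map_prod_map _ _ hl hm,
    ae_map_iff (hl.prodMap hm).aemeasurable hset]
  filter_upwards [Measure.quasiMeasurePreserving_fst.ae hfa,
    Measure.quasiMeasurePreserving_snd.ae hfb,
    (measurePreserving_finAppend σ l m).quasiMeasurePreserving.ae hfr] with w hwa hwb hwr
  simp only [Fin.prod_univ_add, Fin.append_left, Fin.append_right] at hwr
  rw [Prod.map_fst, Prod.map_snd, ← hwa, ← hwb, hwr]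

theorem HasSimpleSpectrum.exists_multiset_add_eq {n : ℕ} (hkn : 2 * k ≤ n)
    (h : HasSimpleSpectrum (symMap n (mulOp σ))) :
    ∃ R T : Circle → Multiset Circle,
      (∀ᵐ s ∂convPow σ k, (R s).card = k ∧ (R s).prod = s) ∧
      ∀ᵐ s ∂(convPow σ k).prod (convPow σ k), R s.1 + R s.2 = T (s.1 * s.2) := by
  let P : Multiset Circle → ℕ → ℂ := fun S => (S.map linearFactors).prod
  have hinv : Function.LeftInverse (Function.invFun P) P :=
    Function.leftInverse_invFun prod_map_linearFactors_injective
  obtain ⟨a, ha, hak⟩ := h.factorsThroughProd_linearFactors (show k ≤ n by omega)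
  obtain ⟨r, hr, hrk⟩ := h.factorsThroughProd_linearFactors (show k + k ≤ n by omega)
  have hroots : ∀ᵐ s ∂convPow σ k, ∃ S : Multiset Circle, S.card = k ∧ S.prod = s ∧ P S = a s :=
    ae_convPow_exists_multiset continuous_linearFactors ha hak
  refine ⟨fun s => Function.invFun P (a s), fun s => Function.invFun P (r s), ?_, ?_⟩
  · filter_upwards [hroots] with s ⟨S, hcard, hprod, hS⟩
    rw [← hS, hinv]
    exact ⟨hcard, hprod⟩
  · filter_upwards [ae_convPow_prod_mul_eq ha ha hr hak hak hrk,
      Measure.quasiMeasurePreserving_fst.ae hroots,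
      Measure.quasiMeasurePreserving_snd.ae hroots] with s hs ⟨S, _, _, hS⟩ ⟨S', _, _, hS'⟩
    have hadd : P (S + S') = r (s.1 * s.2) := by
      rw [← hs, ← hS, ← hS']
      simp only [P, Multiset.map_add, Multiset.prod_add]
    rw [← hS, ← hS', ← hadd, hinv, hinv, hinv]

end Roots

section Boxes

theorem measurableSet_forall_mk_mem {J X Y : Type*} [Countable J] [MeasurableSpace X]
    [MeasurableSpace Y] {A : Set (X × Y)} (hA : MeasurableSet A) :
    MeasurableSet {p : (J → X) × Y | ∀ j, (p.1 j, p.2) ∈ A} := by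
  have hpair (j : J) : Measurable fun p : (J → X) × Y => (p.1 j, p.2) := by fun_prop
  simp only [Set.ofPred_forall]
  exact MeasurableSet.iInter fun j => hpair j hA

variable {J : Type*} [Fintype J] [Nonempty J]

theorem measure_pi_prod_forall_mk_mem_eq_zero_iff {X Y : Type*} [MeasurableSpace X]
    [MeasurableSpace Y] (μ : Measure X) [SigmaFinite μ] (ν : Measure Y) [SFinite ν]
    {A : Set (X × Y)} (hA : MeasurableSet A) :
    ((Measure.pi fun _ : J => μ).prod ν) {p | ∀ j, (p.1 j, p.2) ∈ A} = 0 ↔ (μ.prod ν) A = 0 := by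
  have hB := measurableSet_forall_mk_mem (J := J) hA
  have hfiber (y : Y) : (Measure.pi fun _ : J => μ)
      ((fun x => (x, y)) ⁻¹' {p : (J → X) × Y | ∀ j, (p.1 j, p.2) ∈ A}) =
        μ ((fun x => (x, y)) ⁻¹' A) ^ Fintype.card J := by
    rw [← Finset.card_univ, ← Finset.prod_const, ← Measure.pi_pi]
    congr 1
    ext x
    simp
  rw [Measure.prod_apply_symm hB, Measure.prod_apply_symm hA,
    lintegral_eq_zero_iff (measurable_measure_prodMk_right hB),
    lintegral_eq_zero_iff (measurable_measure_prodMk_right hA)]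
  simp only [hfiber, Filter.EventuallyEq, Pi.zero_apply, pow_eq_zero_iff Fintype.card_ne_zero]

theorem measure_pi_eq_zero_of_measure_pi_box_eq_zero {X : Type*} [MeasurableSpace X] {n : ℕ}
    (ν : Fin n → Measure X) [∀ i, SigmaFinite (ν i)] {A : Set (Fin n → X)} (hA : MeasurableSet A)
    (h : (Measure.pi fun i => Measure.pi fun _ : J => ν i)
      {w | ∀ c : Fin n → J, (fun i => w i (c i)) ∈ A} = 0) : Measure.pi ν A = 0 := by
  induction n with
  | zero =>
    contrapose! h
    obtain ⟨x, hx⟩ := nonempty_of_measure_ne_zero h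
    have hbox : {w : Fin 0 → J → X | ∀ c : Fin 0 → J, (fun i => w i (c i)) ∈ A} = Set.univ :=
      Set.eq_univ_of_forall fun w c => by rwa [Subsingleton.elim (fun i => w i (c i)) x]
    rw [hbox, Measure.pi_univ, Finset.univ_eq_empty, Finset.prod_empty]
    exact one_ne_zero
  | succ n ih =>
    let e := MeasurableEquiv.piFinSuccAbove (fun _ : Fin (n + 1) => X) 0
    let B : Set ((J → X) × (Fin n → X)) := {p | ∀ j, (p.1 j, p.2) ∈ e.symm ⁻¹' A}
    have hA' : MeasurableSet (e.symm ⁻¹' A) := e.symm.measurable hA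
    have hbox : ((Measure.pi fun _ : J => ν 0).prod
        (Measure.pi fun i : Fin n => Measure.pi fun _ : J => ν i.succ))
          {p | ∀ c : Fin n → J, (p.1, fun i => p.2 i (c i)) ∈ B} = 0 := by
      refine ((measurePreserving_piFinSuccAbove
        (fun i => Measure.pi fun _ : J => ν i) 0).measure_preimage_equiv _).symm.trans ?_
      refine measure_mono_null ?_ h
      intro w hw c
      have hpick : e.symm (w 0 (c 0), fun i => w i.succ (c i.succ)) = fun i => w i (c i) :=
        funext fun i => Fin.cases rfl (fun _ => rfl) i
      rw [← hpick]
      exact hw (Fin.tail c) (c 0)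
    have hB : ((Measure.pi fun _ : J => ν 0).prod
        (Measure.pi fun i : Fin n => ν i.succ)) B = 0 := by
      have hmeas : MeasurableSet B := measurableSet_forall_mk_mem hA'
      rw [Measure.measure_prod_null hmeas]
      filter_upwards [Measure.measure_ae_null_of_prod_null hbox] with x hx
      exact ih (fun i => ν i.succ) (measurable_prodMk_left hmeas) hx
    have hnull := (measure_pi_prod_forall_mk_mem_eq_zero_iff _ _ hA').1 hB
    have hpre := (measurePreserving_piFinSuccAbove ν 0).measure_preimage_equiv (e.symm ⁻¹' A)
    rw [← Set.preimage_comp, e.symm_comp_self, Set.preimage_id] at hpre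
    exact hpre.trans hnull

end Boxes

section Choices

variable {X J : Type*} [MeasurableSpace X] [Fintype J]

theorem measurePreserving_eval_prodMk (ν : Measure X) [IsProbabilityMeasure ν] {a b : J}
    (hab : a ≠ b) :
    MeasurePreserving (fun x : J → X => (x a, x b)) (Measure.pi fun _ => ν) (ν.prod ν) := by
  classical
  have hm : Measurable fun x : J → X => (x a, x b) := by fun_prop
  refine ⟨hm, (Measure.prod_eq fun s t hs ht => ?_).symm⟩
  rw [Measure.map_apply hm (hs.prod ht)]
  let u : J → Set X := Function.update (Function.update (fun _ => Set.univ) a s) b t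
  have hpre : (fun x : J → X => (x a, x b)) ⁻¹' s ×ˢ t = Set.pi ({a, b} : Finset J) u := by
    ext x
    simp [u, hab]
  rw [hpre, Measure.pi_pi_finset, Finset.prod_pair hab]
  simp [u, hab]

variable {ι : Type*} [Fintype ι] (ν : ι → Measure X) [∀ i, IsProbabilityMeasure (ν i)]

theorem measurePreserving_choice (c : ι → J) :
    MeasurePreserving (fun (w : ι → J → X) i => w i (c i))
      (Measure.pi fun i => Measure.pi fun _ : J => ν i) (Measure.pi ν) :=
  measurePreserving_pi _ ν fun i => measurePreserving_eval (fun _ : J => ν i) (c i)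

theorem measurePreserving_choice_prodMk {c d : ι → J} (h : ∀ i, c i ≠ d i) :
    MeasurePreserving (fun w : ι → J → X => ((fun i => w i (c i)), fun i => w i (d i)))
      (Measure.pi fun i => Measure.pi fun _ : J => ν i) ((Measure.pi ν).prod (Measure.pi ν)) :=
  (measurePreserving_arrowProdEquivProdArrow X X ι ν ν).comp
    (measurePreserving_pi _ (fun i => (ν i).prod (ν i)) fun i =>
      measurePreserving_eval_prodMk (ν i) (h i))

theorem ae_prod_fst_ne_snd [MeasurableEq X] (μ ν : Measure X) [SFinite ν] [NullSingletonClass ν] :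
    ∀ᵐ p ∂(μ.prod ν), p.1 ≠ p.2 := by
  refine (Measure.ae_prod_iff_ae_ae measurableSet_diagonal.compl).2 (ae_of_all _ fun x => ?_)
  filter_upwards [measure_eq_zero_iff_ae_notMem.1 (measure_singleton (μ := ν) x)] with y hy
  exact fun hxy => hy hxy.symm

theorem ae_pi_pi_ne [MeasurableEq X] [∀ i, NullSingletonClass (ν i)] (i : ι) {a b : J}
    (hab : a ≠ b) :
    ∀ᵐ w ∂(Measure.pi fun i => Measure.pi fun _ : J => ν i), w i a ≠ w i b :=
  ((measurePreserving_eval_prodMk (ν i) hab).comp (measurePreserving_eval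
    (fun i => Measure.pi fun _ : J => ν i) i)).quasiMeasurePreserving.ae (ae_prod_fst_ne_snd _ _)

end Choices

section Exchange

variable {ι α : Type*} [Fintype ι] [DecidableEq ι] {k : ℕ}

theorem exists_singleton_eq_empty_of_separable (hk : k < Fintype.card ι)
    (f : Finset ι → Multiset α) (hcard : ∀ S, (f S).card = k)
    (hsep : ∀ i S, i ∉ S → f (insert i S) + f ∅ = f {i} + f S) : ∃ i, f {i} = f ∅ := by
  classical
  -- Otherwise, adding `i` to the index removes some element `x i` from the multiset; as these
  -- changes are independent of each other, `f ∅` contains all the `x i`, which are too many.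
  by_contra! hne
  have hloss (i : ι) : ∃ x, (f {i}).count x < (f ∅).count x := by
    by_contra! h
    exact hne i (Multiset.eq_of_le_of_card_le (Multiset.le_iff_count.2 h)
      (by rw [hcard, hcard])).symm
  choose x hx using hloss
  have hcount (y : α) (S : Finset ι) (hS : ∀ i ∈ S, x i = y) :
      (f S).count y + S.card ≤ (f ∅).count y := by
    induction S using Finset.induction_on with
    | empty => simp
    | insert i S hi ih =>
      have hsum := congrArg (Multiset.count y) (hsep i S hi)
      rw [Multiset.count_add, Multiset.count_add] at hsum
      have hiy := hx i
      rw [hS i (Finset.mem_insert_self i S)] at hiy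
      have hS' := ih fun j hj => hS j (Finset.mem_insert_of_mem hj)
      rw [Finset.card_insert_of_notMem hi]
      omega
  have hle : Finset.univ.val.map x ≤ f ∅ := by
    refine Multiset.le_iff_count.2 fun y => ?_
    rw [Multiset.count_map]
    exact (Nat.le_add_left _ _).trans (hcount y {i | y = x i} (by simp [eq_comm]))
  have hcard_le := Multiset.card_le_card hle
  rw [hcard, Multiset.card_map] at hcard_le
  exact hk.not_ge hcard_le

theorem exists_update_eq_of_exchange (hk : k < Fintype.card ι) (Q : (ι → Fin 3) → Multiset α)
    (hcard : ∀ c, (Q c).card = k)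
    (hQ : ∀ c d, (∀ i, c i ≠ d i) → ∀ i,
      Q c + Q d = Q (Function.update c i (d i)) + Q (Function.update d i (c i))) :
    ∃ i, Q (Function.update 0 i 1) = Q 0 := by
  let f : Finset ι → Multiset α := fun S => Q (S.piecewise 1 0)
  have hexchange (S : Finset ι) (i : ι) : f S + Q 2 =
      Q (Function.update (S.piecewise 1 0) i 2) +
        Q (Function.update 2 i (S.piecewise (1 : ι → Fin 3) 0 i)) := by
    refine hQ _ 2 (fun j => ?_) i
    by_cases hj : j ∈ S <;> simp [hj]
  have hinsert (i : ι) (S : Finset ι) (hi : i ∉ S) :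
      f (insert i S) + Q (Function.update 2 i 0) = f S + Q (Function.update 2 i 1) := by
    have h1 := hexchange (insert i S) i
    have h0 := hexchange S i
    rw [Finset.piecewise_insert, Function.update_idem, Function.update_self] at h1
    rw [Finset.piecewise_eq_of_notMem _ _ _ hi] at h0
    refine add_right_cancel (b := Q (Function.update (S.piecewise 1 0) i 2) + Q 2) ?_
    calc
      _ = (f (insert i S) + Q 2) +
          (Q (Function.update (S.piecewise 1 0) i 2) + Q (Function.update 2 i 0)) := by abel
      _ = (Q (Function.update (S.piecewise 1 0) i 2) + Q (Function.update 2 i 1)) +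
          (f S + Q 2) := by rw [h1, h0]; rfl
      _ = _ := by abel
  obtain ⟨i, hi⟩ := exists_singleton_eq_empty_of_separable hk f (fun S => hcard _) fun i S hi => by
    refine add_right_cancel (b := Q (Function.update 2 i 0)) ?_
    have hempty := hinsert i ∅ (Finset.notMem_empty i)
    rw [insert_empty_eq] at hempty
    rw [add_right_comm, hinsert i S hi, add_right_comm (f {i}), hempty]
    abel
  refine ⟨i, ?_⟩
  simpa [f, Finset.piecewise_singleton] using hi

theorem prod_update_mul_prod_update {G K : Type*} [CommMonoid G] (w : ι → K → G)
    (c d : ι → K) (i : ι) :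
    (∏ j, w j (Function.update c i (d i) j)) * ∏ j, w j (Function.update d i (c i) j) =
      (∏ j, w j (c j)) * ∏ j, w j (d j) := by
  rw [← Finset.prod_mul_distrib, ← Finset.prod_mul_distrib]
  refine Finset.prod_congr rfl fun j _ => ?_
  rcases eq_or_ne j i with rfl | hj
  · simp [mul_comm]
  · simp [hj]

end Exchange

theorem exists_eq_of_multiset_add_eq {ι G : Type*} [Fintype ι] [CommGroup G] {k : ℕ}
    (hk : k < Fintype.card ι) (w : ι → Fin 3 → G) (R T : G → Multiset G)
    (hR : ∀ c : ι → Fin 3,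
      (R (∏ i, w i (c i))).card = k ∧ (R (∏ i, w i (c i))).prod = ∏ i, w i (c i))
    (hT : ∀ c d : ι → Fin 3, (∀ i, c i ≠ d i) →
      R (∏ i, w i (c i)) + R (∏ i, w i (d i)) = T ((∏ i, w i (c i)) * ∏ i, w i (d i))) :
    ∃ i, w i 0 = w i 1 := by
  classical
  obtain ⟨i, hi⟩ := exists_update_eq_of_exchange hk (fun c => R (∏ i, w i (c i)))
    (fun c => (hR c).1) fun c d hcd i => by
      rw [hT c d hcd, hT, prod_update_mul_prod_update]
      intro j
      rcases eq_or_ne j i with rfl | hj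
      · simpa using (hcd j).symm
      · simpa [hj] using hcd j
  have hprod := congrArg Multiset.prod hi
  rw [(hR _).2, (hR _).2] at hprod
  refine ⟨i, ?_⟩
  simp only [Function.apply_update w] at hprod
  rw [Finset.prod_update_of_mem (Finset.mem_univ i),
    Finset.prod_eq_mul_prod_sdiff_singleton_of_mem (Finset.mem_univ i)] at hprod
  exact (mul_right_cancel hprod).symm

section Singularity

theorem exists_restrict_absolutelyContinuous {X : Type*} [MeasurableSpace X] {ρ ν : Measure X}
    [SigmaFinite ρ] [SigmaFinite ν] (h : ¬ ρ ⟂ₘ ν) :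
    ∃ N, MeasurableSet N ∧ ν N ≠ 0 ∧ ν.restrict N ≪ ρ := by
  obtain ⟨N, hN, hsing, hcompl⟩ := Measure.mutuallySingular_singularPart ν ρ
  refine ⟨N, hN, fun h0 => h ⟨Nᶜ, hN.compl, hcompl, by rwa [compl_compl]⟩, ?_⟩
  rw [Measure.haveLebesgueDecomposition_add ν ρ, Measure.restrict_add,
    Measure.restrict_eq_zero.2 hsing, zero_add]
  exact Measure.restrict_le_self.absolutelyContinuous.trans (withDensity_absolutelyContinuous _ _)

theorem ae_imp_of_restrict_map_absolutelyContinuous {Ω X : Type*} [MeasurableSpace Ω]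
    [MeasurableSpace X] {μ : Measure Ω} {ρ : Measure X} {g : Ω → X} (hg : Measurable g) {N : Set X}
    (hN : MeasurableSet N) (hac : (μ.map g).restrict N ≪ ρ) {p : X → Prop} (h : ∀ᵐ s ∂ρ, p s) :
    ∀ᵐ z ∂μ, g z ∈ N → p (g z) :=
  ae_of_ae_map hg.aemeasurable ((ae_restrict_iff' hN).1 (hac.ae_le h))

theorem restrict_map_prodMap_absolutelyContinuous {Ω X : Type*} [MeasurableSpace Ω]
    [MeasurableSpace X] {μ : Measure Ω} [SFinite μ] {ρ : Measure X} [SFinite ρ] {g : Ω → X}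
    (hg : Measurable g) {N : Set X} (hac : (μ.map g).restrict N ≪ ρ) :
    ((μ.prod μ).map (Prod.map g g)).restrict (N ×ˢ N) ≪ ρ.prod ρ := by
  rw [← Measure.map_prod_map _ _ hg hg, ← Measure.prod_restrict]
  exact hac.prod hac

theorem mutuallySingular_map_prod_of_multiset {G : Type*} [CommGroup G] [MeasurableSpace G]
    [MeasurableMul₂ G] [MeasurableEq G] {ρ : Measure G} [SigmaFinite ρ] {k m : ℕ} (hkm : k < m)
    {R T : G → Multiset G} (hR : ∀ᵐ s ∂ρ, (R s).card = k ∧ (R s).prod = s)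
    (hT : ∀ᵐ s ∂ρ.prod ρ, R s.1 + R s.2 = T (s.1 * s.2)) (ν : Fin m → Measure G)
    [∀ i, IsProbabilityMeasure (ν i)] [∀ i, NullSingletonClass (ν i)] :
    ρ ⟂ₘ (Measure.pi ν).map fun z => ∏ i, z i := by
  by_contra hsing
  have hprod : Measurable fun z : Fin m → G => ∏ i, z i := by fun_prop
  have := Measure.isProbabilityMeasure_map (μ := Measure.pi ν) hprod.aemeasurable
  obtain ⟨N, hN, hN0, hac⟩ := exists_restrict_absolutelyContinuous hsing
  rw [Measure.map_apply hprod hN] at hN0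
  refine hN0 (measure_pi_eq_zero_of_measure_pi_box_eq_zero (J := Fin 3) ν (hprod hN) ?_)
  have hRchoice := ae_all_iff.2 fun c : Fin m → Fin 3 =>
    (measurePreserving_choice ν c).quasiMeasurePreserving.ae
      (ae_imp_of_restrict_map_absolutelyContinuous hprod hN hac hR)
  have hTchoice := ae_all_iff.2 fun c : {c : (Fin m → Fin 3) × (Fin m → Fin 3) //
      ∀ i, c.1 i ≠ c.2 i} => (measurePreserving_choice_prodMk ν c.2).quasiMeasurePreserving.ae
    (ae_imp_of_restrict_map_absolutelyContinuous (hprod.prodMap hprod) (hN.prod hN)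
      (restrict_map_prodMap_absolutelyContinuous hprod hac) hT)
  have hne := ae_all_iff.2 fun i : Fin m =>
    ae_pi_pi_ne ν i (show (0 : Fin 3) ≠ 1 by decide)
  refine measure_eq_zero_iff_ae_notMem.2 ?_
  filter_upwards [hRchoice, hTchoice, hne] with w hRw hTw hwne hbox
  obtain ⟨i, hi⟩ := exists_eq_of_multiset_add_eq (by rwa [Fintype.card_fin]) w R T
    (fun c => hRw c (hbox c)) fun c d hcd => hTw ⟨(c, d), hcd⟩ ⟨hbox c, hbox d⟩
  exact hwne i hi

theorem measure_pi_eq_smul_pi_inv_smul {ι : Type*} [Fintype ι] {X : ι → Type*}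
    [∀ i, MeasurableSpace (X i)] (ν : ∀ i, Measure (X i)) [∀ i, IsFiniteMeasure (ν i)]
    (h : ∀ i, ν i ≠ 0) :
    Measure.pi ν = (∏ i, ν i Set.univ) • Measure.pi fun i => (ν i Set.univ)⁻¹ • ν i := by
  have (i : ι) : NeZero (ν i) := ⟨h i⟩
  refine Measure.pi_eq fun s _ => ?_
  rw [Measure.smul_apply, Measure.pi_pi, smul_eq_mul, ← Finset.prod_mul_distrib]
  refine Finset.prod_congr rfl fun i _ => ?_
  rw [Measure.smul_apply, smul_eq_mul, ← mul_assoc,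
    ENNReal.mul_inv_cancel (NeZero.ne _) (measure_ne_top _ _), one_mul]

theorem hasCS_of_forall_isProbabilityMeasure {ρ : Measure Circle} {m : ℕ}
    (h : ∀ ν : Fin m → Measure Circle, (∀ i, IsProbabilityMeasure (ν i)) →
      (∀ i, NullSingletonClass (ν i)) → ρ ⟂ₘ circleConv ν) : HasCS ρ m := by
  intro ν hfinite hcontinuous
  by_cases hν : ∀ i, ν i ≠ 0
  · have (i : Fin m) : NeZero (ν i) := ⟨hν i⟩
    refine (h (fun i => (ν i Set.univ)⁻¹ • ν i) inferInstance fun i => ⟨fun x => by simp⟩).mono_ac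
      .rfl ?_
    rw [circleConv, circleConv, measure_pi_eq_smul_pi_inv_smul ν hν, Measure.map_smul]
    exact Measure.smul_absolutelyContinuous
  · push Not at hν
    rw [circleConv, measure_pi_eq_zero_iff.2 hν, Measure.map_zero]
    exact Measure.MutuallySingular.zero_right

end Singularity

theorem mainTheorem5_general (σ : Measure Circle) [IsFiniteMeasure σ] {n k : ℕ} (hkn : 2 * k ≤ n)
    (h : HasSimpleSpectrum (symMap n (mulOp σ))) : HasCS (convPow σ k) (k + 1) := by
  obtain ⟨R, T, hR, hT⟩ := h.exists_multiset_add_eq hkn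
  exact hasCS_of_forall_isProbabilityMeasure fun ν _ _ =>
    mutuallySingular_map_prod_of_multiset k.lt_succ_self hR hT ν

theorem mainTheorem5 (σ : Measure Circle) [IsFiniteMeasure σ] [NullSingletonClass σ]
    (h : {n : ℕ | HasSimpleSpectrum (symMap n (mulOp σ))}.Infinite) (k : ℕ) (hk : 1 ≤ k) :
    HasCS (convPow σ k) (k + 1) := by
  obtain ⟨n, hn, hkn⟩ := h.exists_gt (2 * k)
  exact mainTheorem5_general σ hkn.le hn
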